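/- Let $n\ge 1$, let $H_n$ be an $n$-dimensional complex Hilbert space with orthonormal basis $e_1,\dots,e_n$, let $F^2(H_n)=\bigoplus_{k\ge 0}H_n^{\otimes k}$ be the full Fock space (with $H_n^{\otimes 0}=\mathbb C$), and let $S_1,\dots,S_n$ be the left creation operators on it, $S_i\varphi=e_i\otimes\varphi$. Let $\mathbb F_n^+$ be the unital free semigroup on generators $g_1,\dots,g_n$ with identity $g_0$. For a word $\alpha=g_{i_1}\cdots g_{i_k}$ write $|\alpha|=k$ and $X_\alpha=X_{i_1}\cdots X_{i_k}$; write $|g_0|=0$ and $X_{g_0}=I$ (for scalars $r_1,\dots,r_n$, likewise $r_\alpha=r_{i_1}\cdots r_{i_k}$ and $r_{g_0}=1$). For every integer $m\ge 2$ the equation $$\sum_{k=1}^{m-1}t^k\cos\frac{\pi}{\left[\frac{m-1}{k}\right]+2}=\frac12,$$ where $[x]$ is the integer part of $x$, has exactly one positive solution $t_m$, and $t_m\in(0,1]$. The sequence $(t_m)_{m\ge 2}$ is strictly decreasing and converges to $\frac13$. Let $m\ge 2$ and let $p(S_1,\dots,S_n)=\sum_{|\alpha|\le m-1}a_\alpha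 S_\alpha$, $a_\alpha\in\mathbb C$, be a polynomial such that $p(0)=a_{g_0}\ge 0$ and $\operatorname{Re}p(S_1,\dots,S_n)\le I$. Then $$\sum_{k=0}^{m-1}\Big\|\sum_{|\alpha|=k}|a_\alpha|\,T_\alpha\Big\|\le 1$$ for every complex Hilbert space $\mathcal K$ and all bounded operators $T_1,\dots,T_n$ on $\mathcal K$ with $\|T_1T_1^*+\cdots+T_nT_n^*\|^{1/2}\le t_m$. In particular, $$\sum_{|\alpha|\le m-1}|a_\alpha|\,r_\alpha\le 1$$ for all $r=(r_1,\dots,r_n)$ with $r_1,\dots,r_n\ge 0$ and $\|r\|_2=(r_1^2+\cdots+r_n^2)^{1/2}\le t_m$. -/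

import Mathlib

open scoped TensorProduct ComplexOrder

universe u

noncomputable section

namespace BohrNC

/-! ### The full Fock space and the left creation operators -/

/-- A finite-dimensional complex Hilbert space, bundled with its structure. -/
structure FinHilb where
  carrier : Type
  [group : NormedAddCommGroup carrier]
  [inner : InnerProductSpace ℂ carrier]
  [finite : FiniteDimensional ℂ carrier]

attribute [instance] FinHilb.group FinHilb.inner FinHilb.finite

/-- The Hilbert tensor powers of `H_n = ℂⁿ`: `H_n^{⊗0} = ℂ` and `H_n^{⊗(k+1)} = H_n ⊗ H_n^{⊗k}`,
with Mathlib's inner product `⟪a ⊗ b, c ⊗ d⟫ = ⟪a, c⟫ * ⟪b, d⟫`. -/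
def tensorPowBundle (n : ℕ) : ℕ → FinHilb
  | 0 => ⟨ℂ⟩
  | k + 1 => ⟨EuclideanSpace ℂ (Fin n) ⊗[ℂ] (tensorPowBundle n k).carrier⟩

/-- The space `H_n^{⊗k}`. -/
abbrev TensorPow (n k : ℕ) : Type := (tensorPowBundle n k).carrier

instance (n k : ℕ) : CompleteSpace (TensorPow n k) := FiniteDimensional.complete ℂ _

/-- The full Fock space `F²(H_n) = ⨁_{k ≥ 0} H_n^{⊗k}` (Hilbert space direct sum). -/
abbrev Fock (n : ℕ) : Type := lp (fun k : ℕ => TensorPow n k) 2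

/-- The map `x ↦ e ⊗ x` from `H_n^{⊗k}` to `H_n^{⊗(k+1)}`. -/
def tensorLeft {n : ℕ} (e : EuclideanSpace ℂ (Fin n)) (k : ℕ) :
    TensorPow n k →ₗ[ℂ] TensorPow n (k + 1) :=
  TensorProduct.mk ℂ (EuclideanSpace ℂ (Fin n)) (TensorPow n k) e

theorem norm_tensorLeft {n : ℕ} (e : EuclideanSpace ℂ (Fin n)) (k : ℕ) (x : TensorPow n k) :
    ‖tensorLeft e k x‖ = ‖e‖ * ‖x‖ :=
  TensorProduct.norm_tmul e x

/-- The components of `e ⊗ φ`: degree `0` is `0`, and degree `k + 1` is `e ⊗ φ_k`. -/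
def creationFun {n : ℕ} (e : EuclideanSpace ℂ (Fin n)) (φ : ∀ k, TensorPow n k) :
    ∀ k, TensorPow n k
  | 0 => 0
  | k + 1 => tensorLeft e k (φ k)

theorem hasSum_creationFun {n : ℕ} (e : EuclideanSpace ℂ (Fin n)) (φ : Fock n) :
    HasSum (fun k => ‖creationFun e (φ : ∀ k, TensorPow n k) k‖ ^ 2) (‖e‖ ^ 2 * ‖φ‖ ^ 2) := by
  have h : HasSum (fun k => ‖φ k‖ ^ 2) (‖φ‖ ^ 2) := by
    have := lp.hasSum_norm (p := 2) (by norm_num) φ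
    simpa using this
  have h2 := h.mul_left (‖e‖ ^ 2)
  rw [← hasSum_nat_add_iff' 1]
  simpa [creationFun, norm_tensorLeft, mul_pow] using h2

theorem memℓp_creationFun {n : ℕ} (e : EuclideanSpace ℂ (Fin n)) (φ : Fock n) :
    Memℓp (creationFun e (φ : ∀ k, TensorPow n k)) 2 := by
  apply memℓp_gen
  simpa using (hasSum_creationFun e φ).summable

/-- The left creation operator `φ ↦ e ⊗ φ` on the full Fock space. -/
def leftCreation {n : ℕ} (e : EuclideanSpace ℂ (Fin n)) : Fock n →L[ℂ] Fock n :=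
  LinearMap.mkContinuous
    { toFun := fun φ => ⟨creationFun e φ, memℓp_creationFun e φ⟩
      map_add' := by
        intro φ ψ
        ext k
        change creationFun e (φ + ψ : Fock n) k = creationFun e φ k + creationFun e ψ k
        cases k <;> simp [creationFun]
      map_smul' := by
        intro c φ
        ext k
        cases k <;> simp [creationFun] }
    ‖e‖
    (by
      intro φ
      have h := hasSum_creationFun e φ
      have h' := lp.hasSum_norm (p := 2) (by norm_num)
        (⟨creationFun e φ, memℓp_creationFun e φ⟩ : Fock n)
      have h2 : HasSum (fun k => ‖creationFun e (φ : ∀ k, TensorPow n k) k‖ ^ 2)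
          (‖(⟨creationFun e φ, memℓp_creationFun e φ⟩ : Fock n)‖ ^ 2) := by
        simpa using h'
      have h3 := h2.unique h
      rw [← mul_pow] at h3
      exact le_of_eq ((sq_eq_sq₀ (norm_nonneg _) (by positivity)).1 h3))

/-- The left creation operators `S_1, …, S_n`, `S_i φ = e_i ⊗ φ`. -/
def S (n : ℕ) (i : Fin n) : Fock n →L[ℂ] Fock n :=
  leftCreation (EuclideanSpace.single i (1 : ℂ))

/-! ### Words and noncommutative polynomials -/

/-- The words of length `k` in the free monoid on `n` generators. -/
def words (n k : ℕ) : Finset (FreeMonoid (Fin n)) :=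
  Finset.univ.map
    ⟨fun w : Fin k → Fin n => FreeMonoid.ofList (List.ofFn w),
      fun _ _ h => List.ofFn_injective (FreeMonoid.ofList.injective h)⟩

theorem mem_words {n k : ℕ} {α : FreeMonoid (Fin n)} : α ∈ words n k ↔ α.length = k := by
  constructor
  · intro h
    obtain ⟨w, -, rfl⟩ := Finset.mem_map.1 h
    exact List.length_ofFn
  · rintro rfl
    exact Finset.mem_map.2 ⟨α.toList.get, Finset.mem_univ _, List.ofFn_get α.toList⟩

/-- `X_α = X_{i_1} ⋯ X_{i_k}` for a word `α = g_{i_1} ⋯ g_{i_k}`, and `X_α = 1` for the empty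
word. -/
def wordEval {n : ℕ} {A : Type*} [Monoid A] (X : Fin n → A) (α : FreeMonoid (Fin n)) : A :=
  FreeMonoid.lift X α

/-- The homogeneous polynomial `∑_{|α| = k} a_α X_α`. -/
def homPart {n : ℕ} {R A : Type*} [CommSemiring R] [Semiring A] [Algebra R A]
    (a : FreeMonoid (Fin n) → R) (k : ℕ) (X : Fin n → A) : A :=
  ∑ α ∈ words n k, a α • wordEval X α

/-- The polynomial `∑_{|α| ≤ m - 1} a_α X_α`; here `m ≥ 1`. -/
def ncPoly {n : ℕ} {R A : Type*} [CommSemiring R] [Semiring A] [Algebra R A]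
    (a : FreeMonoid (Fin n) → R) (m : ℕ) (X : Fin n → A) : A :=
  ∑ k ∈ Finset.range m, homPart a k X

/-- `f_m(t) = ∑_{k=1}^{m-1} t^k cos(π / ([(m-1)/k] + 2))`. The quotient `(m - 1) / k` is the
floored quotient of natural numbers. -/
def fejerSum (m : ℕ) (t : ℝ) : ℝ :=
  ∑ k ∈ Finset.Icc 1 (m - 1), t ^ k * Real.cos (Real.pi / ((((m - 1) / k : ℕ) : ℝ) + 2))

end BohrNC

end

namespace BohrNC

/-! ### Fejér's coefficient inequality -/

/-! Write `P_k` for the degree `k` part of `p(S)`, `b_k` for the ℓ² norm of its coefficients, and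
`c_k` for the cosine attached to `k`. Everything rests on `b_k ≤ 2 c_k (1 - a_0)` for `1 ≤ k < m`
(`sqrt_sum_sq_coeff_le`). Rotating a vector by the gauge action turns `Re p(S) ≤ I` into an upper
bound on the circle for the trigonometric polynomial with coefficients `⟪φ, P_k φ⟫`. Fejér's
inequality (`fejer`) then bounds `Re ⟪φ, P_k φ⟫`. Since `P_k` is `b_k` times an isometry with a
wandering vector, such a bound already controls `b_k` (`le_of_re_inner_le`). Cauchy–Schwarz over
words gives `‖∑ |a_α| T_α‖ ≤ b_k t^k` when the row norm is at most `t` (`norm_homPart_le`). Summing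
at `t = t_m` gives at most `a_0 + 2 (1 - a_0) · 1/2 = 1`. The claims about `t_m` follow from
monotonicity of the sum in `t` and in `m`; as `m → ∞` the cosines tend to `1`, and `∑ t^k = 1/2` has
the solution `1/3`. -/

theorem cos_odd_mul_le_cos {q : ℕ} (hq : 1 ≤ q) (j : ℕ) :
    Real.cos ((2 * j + 1) * (Real.pi / q)) ≤ Real.cos (Real.pi / q) := by
  have hq0 : (0 : ℝ) < q := by exact_mod_cast hq
  obtain ⟨i, s, hi, rfl⟩ : ∃ i s : ℕ, i < q ∧ j = i + s * q :=
    ⟨j % q, j / q, Nat.mod_lt _ hq, by rw [mul_comm]; exact (Nat.mod_add_div j q).symm⟩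
  have h1 : (2 * ((i + s * q : ℕ) : ℝ) + 1) * (Real.pi / q)
      = (2 * i + 1) * (Real.pi / q) + s * (2 * Real.pi) := by
    push_cast
    field_simp
    ring
  rw [h1, Real.cos_add_nat_mul_two_pi, ← sub_nonneg, Real.cos_sub_cos]
  have h2 : (Real.pi / q + (2 * i + 1) * (Real.pi / q)) / 2 = (i + 1) * Real.pi / q := by ring
  have h3 : (Real.pi / q - (2 * i + 1) * (Real.pi / q)) / 2 = -(i * Real.pi / q) := by ring
  have hiq : (i : ℝ) + 1 ≤ q := by exact_mod_cast hi
  have hpi := Real.pi_pos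
  have s1 : 0 ≤ Real.sin ((i + 1) * Real.pi / q) :=
    Real.sin_nonneg_of_nonneg_of_le_pi (by positivity)
      (by rw [div_le_iff₀ hq0]; nlinarith)
  have s2 : 0 ≤ Real.sin (i * Real.pi / q) :=
    Real.sin_nonneg_of_nonneg_of_le_pi (by positivity)
      (by rw [div_le_iff₀ hq0]; nlinarith)
  rw [h2, h3, Real.sin_neg]
  nlinarith [mul_nonneg s1 s2]

/-- The `N` solutions of `z ^ N = -1`. -/
noncomputable def negRoot (N j : ℕ) : ℂ :=
  Complex.exp (Real.pi / N * Complex.I) * Complex.exp (2 * Real.pi * Complex.I / N) ^ j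

theorem negRoot_eq_exp (N j : ℕ) :
    negRoot N j = Complex.exp (((2 * j + 1) * (Real.pi / N) : ℝ) * Complex.I) := by
  rw [negRoot, ← Complex.exp_nat_mul, ← Complex.exp_add]
  congr 1
  push_cast
  ring

theorem norm_negRoot (N j : ℕ) : ‖negRoot N j‖ = 1 := by
  rw [negRoot_eq_exp, Complex.norm_exp_ofReal_mul_I]

theorem re_negRoot_pow (N j k : ℕ) :
    (negRoot N j ^ k).re = Real.cos (k * ((2 * j + 1) * (Real.pi / N))) := by
  rw [negRoot_eq_exp, ← Complex.exp_nat_mul, ← Complex.exp_ofReal_mul_I_re]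
  congr 2
  push_cast
  ring

theorem sum_negRoot_zpow {N : ℕ} (hN : N ≠ 0) {l : ℤ} (hl : ¬ (N : ℤ) ∣ l) :
    ∑ j ∈ Finset.range N, negRoot N j ^ l = 0 := by
  have hp := Complex.isPrimitiveRoot_exp N hN
  set ξ := Complex.exp (2 * Real.pi * Complex.I / N) with hξ
  have h1 : ξ ^ l ≠ 1 := fun h => hl ((hp.zpow_eq_one_iff_dvd l).1 h)
  have h2 : ∀ j ∈ Finset.range N, negRoot N j ^ l
      = Complex.exp (Real.pi / N * Complex.I) ^ l * (ξ ^ l) ^ j := by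
    intro j _
    rw [negRoot, mul_zpow, ← hξ, ← zpow_natCast, ← zpow_natCast, ← zpow_mul, ← zpow_mul,
      mul_comm l]
  rw [Finset.sum_congr rfl h2, ← Finset.mul_sum, geom_sum_eq h1, ← zpow_natCast, ← zpow_mul,
    mul_comm l, zpow_mul, zpow_natCast, hp.pow_eq_one]
  simp

theorem sum_negRoot_zpow_of_abs_lt {N : ℕ} {l : ℤ} (hl : |l| < N) :
    ∑ j ∈ Finset.range N, negRoot N j ^ l = if l = 0 then (N : ℂ) else 0 := by
  split_ifs with h
  · simp [h]
  · refine sum_negRoot_zpow (by rintro rfl; exact (abs_nonneg l).not_gt (by simpa using hl)) ?_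
    exact fun hd => h (Int.eq_zero_of_abs_lt_dvd hd hl)

/-- Fejér's inequality for the coefficients of a trigonometric polynomial bounded above, in the
version for the lower bound. -/
theorem fejer_neg {m k : ℕ} (hk : 1 ≤ k) (hkm : k < m) (u : ℕ → ℂ) (b : ℝ)
    (h : ∀ z : ℂ, ‖z‖ = 1 → (∑ l ∈ Finset.range m, z ^ l * u l).re ≤ b) :
    -(u k).re ≤
      2 * Real.cos (Real.pi / ((((m - 1) / k : ℕ) : ℝ) + 2)) * (b - (u 0).re) := by
  obtain ⟨q, hq⟩ : ∃ q, q = (m - 1) / k + 2 := ⟨_, rfl⟩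
  have hqr : ((((m - 1) / k : ℕ) : ℝ) + 2) = (q : ℝ) := by rw [hq]; push_cast; ring
  rw [hqr]
  have hq1 : 1 ≤ q := hq ▸ Nat.succ_pos _
  -- `q` is the least integer with `k q > m - 1 + k`, so all frequencies `l` and `l ± k` with `l <
  -- m` are smaller than `N` in absolute value and do not alias.
  set N := k * q with hN
  have hNm : m - 1 + k < N := by
    have := Nat.lt_mul_div_succ (m - 1) (show 0 < k by omega)
    rw [hN, hq]
    have e : k * ((m - 1) / k + 2) = k * ((m - 1) / k + 1) + k := by ring
    omega
  have hN0 : (0 : ℝ) < N := by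
    have : 0 < N := by lia
    exact_mod_cast this
  set C := Real.cos (Real.pi / q) with hC
  set z := negRoot N with hz
  have hz1 : ∀ j, ‖z j‖ = 1 := norm_negRoot N
  have hz0 : ∀ j, z j ≠ 0 := fun j h0 => by simpa [h0] using hz1 j
  -- Averaging against these weights isolates `C u_0 - u_k / 2`. They are nonnegative because `z_j ^
  -- k` is a `q`-th root of `-1`, whose real part is at most `cos (π / q)`.
  set w : ℕ → ℝ := fun j => C - (z j ^ k).re with hw
  have hw0 : ∀ j, 0 ≤ w j := by
    intro j
    simp only [hw, hz, re_negRoot_pow, sub_nonneg, hC]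
    refine le_trans (le_of_eq ?_) (cos_odd_mul_le_cos hq1 j)
    congr 1
    have : (k : ℝ) ≠ 0 := by positivity
    have : (q : ℝ) ≠ 0 := by positivity
    rw [hN]
    push_cast
    field_simp
  have hwz : ∀ j (l : ℕ), (w j : ℂ) * z j ^ l
      = C * z j ^ (l : ℤ) - (z j ^ ((l : ℤ) + k) + z j ^ ((l : ℤ) - k)) / 2 := by
    intro j l
    have hc : (starRingEnd ℂ) (z j ^ k) = z j ^ (-(k : ℤ)) := by
      rw [map_pow, zpow_neg, zpow_natCast, ← inv_pow, Complex.inv_eq_conj (hz1 j)]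
    have hr : (((z j ^ k).re : ℝ) : ℂ) = (z j ^ (k : ℤ) + z j ^ (-(k : ℤ))) / 2 := by
      rw [Complex.re_eq_add_conj, hc, zpow_natCast]
    rw [hw]
    push_cast
    rw [hr, sub_eq_add_neg (l : ℤ), zpow_add₀ (hz0 j), zpow_add₀ (hz0 j), zpow_natCast,
      zpow_natCast]
    ring
  have hsum : ∀ l : ℕ, l < m → ∑ j ∈ Finset.range N, (w j : ℂ) * z j ^ l
      = N * ((if l = 0 then (C : ℂ) else 0) - (if l = k then 1 / 2 else 0)) := by
    intro l hl
    simp_rw [hwz]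
    rw [Finset.sum_sub_distrib, ← Finset.mul_sum, ← Finset.sum_div, Finset.sum_add_distrib, hz,
      sum_negRoot_zpow_of_abs_lt (l := (l : ℤ)) (by rw [abs_lt]; omega),
      sum_negRoot_zpow_of_abs_lt (l := (l : ℤ) + k) (by rw [abs_lt]; omega),
      sum_negRoot_zpow_of_abs_lt (l := (l : ℤ) - k) (by rw [abs_lt]; omega), if_neg (by omega : ¬ (l : ℤ) + k = 0)]
    have e1 : (l : ℤ) = 0 ↔ l = 0 := by omega
    have e2 : (l : ℤ) - k = 0 ↔ l = k := by omega
    simp only [e1, e2]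
    split_ifs <;> ring
  have hws : ∑ j ∈ Finset.range N, w j = N * C := by
    have := hsum 0 (by omega)
    simp only [pow_zero, mul_one, if_true, if_neg (by omega : ¬ 0 = k), sub_zero] at this
    exact_mod_cast this
  have key : ∑ j ∈ Finset.range N, w j * (∑ l ∈ Finset.range m, z j ^ l * u l).re
      ≤ ∑ j ∈ Finset.range N, w j * b :=
    Finset.sum_le_sum fun j _ => mul_le_mul_of_nonneg_left (h _ (hz1 j)) (hw0 j)
  have hL : ∑ j ∈ Finset.range N, w j * (∑ l ∈ Finset.range m, z j ^ l * u l).re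
      = N * (C * (u 0).re - (u k).re / 2) := by
    have : ∑ j ∈ Finset.range N, (w j : ℂ) * (∑ l ∈ Finset.range m, z j ^ l * u l)
        = N * (C * u 0 - u k / 2) := by
      simp_rw [Finset.mul_sum]
      rw [Finset.sum_comm]
      simp_rw [← mul_assoc, ← Finset.sum_mul]
      rw [Finset.sum_congr rfl fun l hl => by rw [hsum l (Finset.mem_range.1 hl)]]
      simp only [mul_sub, sub_mul, Finset.sum_sub_distrib, mul_ite, mul_zero, ite_mul, zero_mul,
        Finset.sum_ite_eq', Finset.mem_range]
      rw [if_pos (by omega), if_pos hkm]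
      ring
    have h2 := congrArg Complex.re this
    rw [Complex.re_sum] at h2
    simp only [Complex.re_ofReal_mul] at h2
    rw [h2, ← Complex.ofReal_natCast, Complex.re_ofReal_mul, Complex.sub_re,
      Complex.re_ofReal_mul]
    congr 2
    simp
  rw [hL, ← Finset.sum_mul, hws, mul_assoc] at key
  have := le_of_mul_le_mul_left key hN0
  linarith

/-- Fejér's inequality: if `Re ∑_{l < m} u_l z^l ≤ b` on the unit circle, then
`Re u_k ≤ 2 (b - Re u_0) cos (π / ([(m - 1) / k] + 2))`. -/
theorem fejer {m k : ℕ} (hk : 1 ≤ k) (hkm : k < m) (u : ℕ → ℂ) (b : ℝ)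
    (h : ∀ z : ℂ, ‖z‖ = 1 → (∑ l ∈ Finset.range m, z ^ l * u l).re ≤ b) :
    (u k).re ≤
      2 * Real.cos (Real.pi / ((((m - 1) / k : ℕ) : ℝ) + 2)) * (b - (u 0).re) := by
  -- Rotating the circle by a `k`-th root of `-1` flips the sign of `u_k` and fixes `u_0`.
  set ω : ℂ := Complex.exp ((Real.pi / k : ℝ) * Complex.I) with hω
  have hω1 : ‖ω‖ = 1 := Complex.norm_exp_ofReal_mul_I _
  have hωk : ω ^ k = -1 := by
    rw [hω, ← Complex.exp_nat_mul, ← Complex.exp_pi_mul_I]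
    congr 1
    have : (k : ℂ) ≠ 0 := by exact_mod_cast (by omega : k ≠ 0)
    push_cast
    field_simp
  have := fejer_neg hk hkm (fun l => ω ^ l * u l) b (by
    intro z hz
    simp_rw [← mul_assoc, ← mul_pow]
    exact h _ (by simp [hz, hω1]))
  simpa [hωk] using this

/-! ### The solutions of the equation -/

theorem cos_pi_div_add_two_mono {i j : ℕ} (hij : i ≤ j) :
    Real.cos (Real.pi / ((i : ℝ) + 2)) ≤ Real.cos (Real.pi / ((j : ℝ) + 2)) := by
  have hpi := Real.pi_pos
  apply Real.cos_le_cos_of_nonneg_of_le_pi (by positivity)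
  · exact div_le_self hpi.le (by linarith [(Nat.cast_nonneg i : (0 : ℝ) ≤ i)])
  · have : (i : ℝ) ≤ j := by exact_mod_cast hij
    gcongr

theorem cos_pi_div_add_two_strictMono {i j : ℕ} (hij : i < j) :
    Real.cos (Real.pi / ((i : ℝ) + 2)) < Real.cos (Real.pi / ((j : ℝ) + 2)) := by
  have hpi := Real.pi_pos
  apply Real.cos_lt_cos_of_nonneg_of_le_pi (by positivity)
  · exact div_le_self hpi.le (by linarith [(Nat.cast_nonneg i : (0 : ℝ) ≤ i)])
  · have : (i : ℝ) < j := by exact_mod_cast hij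
    gcongr

theorem half_le_cos_pi_div_add_two {j : ℕ} (hj : 1 ≤ j) :
    1 / 2 ≤ Real.cos (Real.pi / ((j : ℝ) + 2)) := by
  refine le_trans (le_of_eq ?_) (cos_pi_div_add_two_mono hj)
  rw [← Real.cos_pi_div_three]
  norm_num

theorem cos_pi_div_add_two_nonneg (j : ℕ) : 0 ≤ Real.cos (Real.pi / ((j : ℝ) + 2)) := by
  refine le_trans (le_of_eq ?_) (cos_pi_div_add_two_mono (Nat.zero_le j))
  simp

theorem fejerSum_strictMonoOn {m : ℕ} (hm : 2 ≤ m) :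
    StrictMonoOn (fejerSum m) (Set.Ici 0) := by
  intro s hs t _ hst
  refine Finset.sum_lt_sum (fun k _ => ?_) ⟨1, Finset.mem_Icc.2 ⟨le_rfl, by omega⟩, ?_⟩
  · exact mul_le_mul_of_nonneg_right (pow_le_pow_left₀ hs hst.le k) (cos_pi_div_add_two_nonneg _)
  · have := half_le_cos_pi_div_add_two (j := (m - 1) / 1) (by simp; omega)
    rw [pow_one, pow_one]
    exact mul_lt_mul_of_pos_right hst (by linarith)

theorem continuous_fejerSum (m : ℕ) : Continuous (fejerSum m) := by
  unfold fejerSum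
  fun_prop

theorem fejerSum_zero (m : ℕ) : fejerSum m 0 = 0 := by
  refine Finset.sum_eq_zero fun k hk => ?_
  rw [zero_pow (by have := (Finset.mem_Icc.1 hk).1; omega), zero_mul]

theorem half_le_fejerSum_one {m : ℕ} (hm : 2 ≤ m) : 1 / 2 ≤ fejerSum m 1 := by
  have h := Finset.single_le_sum (s := Finset.Icc 1 (m - 1))
    (f := fun k => (1 : ℝ) ^ k * Real.cos (Real.pi / ((((m - 1) / k : ℕ) : ℝ) + 2)))
    (fun k _ => by simpa using cos_pi_div_add_two_nonneg _)
    (Finset.mem_Icc.2 ⟨le_rfl, (by omega : 1 ≤ m - 1)⟩)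
  have h2 := half_le_cos_pi_div_add_two (j := (m - 1) / 1) (by simp; omega)
  simp only [one_pow, one_mul] at h
  unfold fejerSum
  simp only [one_pow, one_mul]
  exact h2.trans h

theorem fejerSum_lt_of_lt {m m' : ℕ} (hm : 2 ≤ m) (hmm : m < m') {t : ℝ} (ht : 0 < t) :
    fejerSum m t < fejerSum m' t := by
  refine lt_of_lt_of_le
    (b := ∑ k ∈ Finset.Icc 1 (m - 1),
      t ^ k * Real.cos (Real.pi / ((((m' - 1) / k : ℕ) : ℝ) + 2))) ?_ ?_
  · refine Finset.sum_lt_sum (fun k _ => ?_) ⟨1, Finset.mem_Icc.2 ⟨le_rfl, by omega⟩, ?_⟩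
    · exact mul_le_mul_of_nonneg_left
        (cos_pi_div_add_two_mono (Nat.div_le_div_right (by omega))) (by positivity)
    · exact mul_lt_mul_of_pos_left
        (cos_pi_div_add_two_strictMono (by simp; omega)) (by positivity)
  · exact Finset.sum_le_sum_of_subset_of_nonneg (Finset.Icc_subset_Icc le_rfl (by omega))
      fun k _ _ => mul_nonneg (by positivity) (cos_pi_div_add_two_nonneg _)

/-- With every cosine replaced by `1`, this is a partial sum of a geometric series with total `1/2`.
-/
theorem fejerSum_third_lt (m : ℕ) : fejerSum m (1 / 3) < 1 / 2 := by
  have h1 : fejerSum m (1 / 3) ≤ ∑ k ∈ Finset.Icc 1 (m - 1), (1 / 3 : ℝ) ^ k :=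
    Finset.sum_le_sum fun k _ => mul_le_of_le_one_right (by positivity) (Real.cos_le_one _)
  have h2 : ∀ M : ℕ, ∑ k ∈ Finset.Icc 1 M, (1 / 3 : ℝ) ^ k = 1 / 2 - (1 / 3) ^ M / 2 := by
    intro M
    induction M with
    | zero => simp
    | succ M ih => rw [Finset.sum_Icc_succ_top (by omega), ih]; ring
  have h3 : (0 : ℝ) < (1 / 3) ^ (m - 1) := by positivity
  rw [h2] at h1
  linarith

theorem exists_sum_pow_gt_half {t : ℝ} (ht : 1 / 3 < t) :
    ∃ M : ℕ, 1 / 2 < ∑ k ∈ Finset.Icc 1 M, t ^ k := by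
  obtain ⟨s, hs, hst, hs1⟩ : ∃ s : ℝ, 1 / 3 < s ∧ s ≤ t ∧ s < 1 :=
    ⟨min t (1 / 2), lt_min ht (by norm_num), min_le_left _ _,
      (min_le_right _ _).trans_lt (by norm_num)⟩
  have h2 : ∀ M : ℕ, ∑ k ∈ Finset.Icc 1 M, s ^ k = (s - s ^ (M + 1)) / (1 - s) := by
    intro M
    have : (1 - s) ≠ 0 := by linarith
    induction M with
    | zero => simp
    | succ M ih => rw [Finset.sum_Icc_succ_top (by omega), ih]; field_simp; ring
  -- The partial sum exceeds `1/2` exactly when `s ^ (M + 1) < (3 s - 1) / 2`.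
  have hpos : 0 < (3 * s - 1) / 2 := by linarith
  obtain ⟨M, hM⟩ := exists_pow_lt_of_lt_one hpos hs1
  refine ⟨M, lt_of_lt_of_le ?_
    (Finset.sum_le_sum fun k _ => pow_le_pow_left₀ (by linarith) hst k)⟩
  have : s ^ (M + 1) ≤ s ^ M := pow_le_pow_of_le_one (by linarith) hs1.le (by omega)
  rw [h2, lt_div_iff₀ (by linarith)]
  linarith

theorem tendsto_cos_pi_div (k : ℕ) (hk : 1 ≤ k) :
    Filter.Tendsto (fun m : ℕ => Real.cos (Real.pi / ((((m - 1) / k : ℕ) : ℝ) + 2)))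
      Filter.atTop (nhds 1) := by
  have h1 : Filter.Tendsto (fun m : ℕ => (m - 1) / k) Filter.atTop Filter.atTop :=
    (Nat.tendsto_div_const_atTop (by omega)).comp (Filter.tendsto_sub_atTop_nat 1)
  have h2 : Filter.Tendsto (fun m : ℕ => Real.pi / ((((m - 1) / k : ℕ) : ℝ) + 2))
      Filter.atTop (nhds 0) :=
    Filter.Tendsto.const_div_atTop
      (Filter.tendsto_atTop_add_const_right _ _ (tendsto_natCast_atTop_atTop.comp h1)) _
  simpa [Function.comp_def] using (Real.continuous_cos.tendsto 0).comp h2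

/-- Finitely many terms of the geometric series already exceed `1/2`; their cosines tend to `1`, and
the remaining terms are nonnegative. -/
theorem eventually_fejerSum_gt_half {t : ℝ} (ht : 1 / 3 < t) :
    ∀ᶠ m : ℕ in Filter.atTop, 1 / 2 < fejerSum m t := by
  obtain ⟨M, hM⟩ := exists_sum_pow_gt_half ht
  have h1 : Filter.Tendsto (fun m : ℕ => ∑ k ∈ Finset.Icc 1 M,
      t ^ k * Real.cos (Real.pi / ((((m - 1) / k : ℕ) : ℝ) + 2))) Filter.atTop
      (nhds (∑ k ∈ Finset.Icc 1 M, t ^ k * 1)) :=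
    tendsto_finsetSum _ fun k hk =>
      (tendsto_cos_pi_div k (Finset.mem_Icc.1 hk).1).const_mul _
  simp only [mul_one] at h1
  filter_upwards [h1.eventually (lt_mem_nhds hM), Filter.eventually_ge_atTop (M + 1)]
    with m hm hmM
  refine hm.trans_le (Finset.sum_le_sum_of_subset_of_nonneg
    (Finset.Icc_subset_Icc le_rfl (by omega)) fun k _ _ => ?_)
  have : 0 < t := by linarith
  exact mul_nonneg (by positivity) (cos_pi_div_add_two_nonneg _)

theorem exists_unique_fejerSum_eq_half {m : ℕ} (hm : 2 ≤ m) :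
    ∃ t ∈ Set.Ioc (0 : ℝ) 1, ∀ s : ℝ, 0 < s → (fejerSum m s = 1 / 2 ↔ s = t) := by
  obtain ⟨t, ⟨ht0, ht1⟩, ht⟩ := intermediate_value_Icc (zero_le_one (α := ℝ))
    (continuous_fejerSum m).continuousOn
    (show (1 / 2 : ℝ) ∈ Set.Icc (fejerSum m 0) (fejerSum m 1) from
      ⟨by rw [fejerSum_zero]; norm_num, half_le_fejerSum_one hm⟩)
  have ht0' : t ≠ 0 := by
    rintro rfl
    rw [fejerSum_zero] at ht
    norm_num at ht
  refine ⟨t, ⟨lt_of_le_of_ne ht0 ht0'.symm, ht1⟩, fun s hs => ⟨fun h => ?_, fun h => h ▸ ht⟩⟩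
  exact (fejerSum_strictMonoOn hm).injOn hs.le ht0 (h.trans ht.symm)

theorem exists_fejerSum_solutions : ∃ t : ℕ → ℝ,
    (∀ m : ℕ, 2 ≤ m → t m ∈ Set.Ioc (0 : ℝ) 1 ∧
      ∀ s : ℝ, 0 < s → (fejerSum m s = 1 / 2 ↔ s = t m)) ∧
    StrictAntiOn t (Set.Ici 2) ∧ Filter.Tendsto t Filter.atTop (nhds (1 / 3)) := by
  have hex : ∀ m : ℕ, ∃ t : ℝ, 2 ≤ m → t ∈ Set.Ioc (0 : ℝ) 1 ∧
      ∀ s : ℝ, 0 < s → (fejerSum m s = 1 / 2 ↔ s = t) := by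
    intro m
    by_cases hm : 2 ≤ m
    · obtain ⟨t, ht⟩ := exists_unique_fejerSum_eq_half hm
      exact ⟨t, fun _ => ht⟩
    -- The value for `m < 2` is arbitrary.
    · exact ⟨0, fun h => absurd h hm⟩
  choose t ht using hex
  have hval : ∀ m, 2 ≤ m → fejerSum m (t m) = 1 / 2 := fun m hm =>
    ((ht m hm).2 _ (ht m hm).1.1).2 rfl
  have hlt : ∀ m, 2 ≤ m → ∀ s : ℝ, 0 < s → (s < t m ↔ fejerSum m s < 1 / 2) := by
    intro m hm s hs
    rw [← hval m hm]
    exact ((fejerSum_strictMonoOn hm).lt_iff_lt hs.le (ht m hm).1.1.le).symm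
  have hgt : ∀ m, 2 ≤ m → ∀ s : ℝ, 0 < s → (t m < s ↔ 1 / 2 < fejerSum m s) := by
    intro m hm s hs
    rw [← hval m hm]
    exact ((fejerSum_strictMonoOn hm).lt_iff_lt (ht m hm).1.1.le hs.le).symm
  refine ⟨t, ht, fun m hm m' hm' hmm => ?_, ?_⟩
  · rw [hgt m' hm' _ (ht m hm).1.1, ← hval m hm]
    exact fejerSum_lt_of_lt hm hmm (ht m hm).1.1
  · refine tendsto_order.2 ⟨fun s hs => ?_, fun s hs => ?_⟩
    · filter_upwards [Filter.eventually_ge_atTop 2] with m hm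
      exact hs.trans ((hlt m hm _ (by norm_num)).2 (fejerSum_third_lt m))
    · filter_upwards [Filter.eventually_ge_atTop 2, eventually_fejerSum_gt_half hs] with m hm h
      exact (hgt m hm s (by linarith)).2 h

/-! ### Words -/

theorem wordEval_of_mul {n : ℕ} {A : Type*} [Monoid A] (X : Fin n → A) (i : Fin n)
    (α : FreeMonoid (Fin n)) : wordEval X (FreeMonoid.of i * α) = X i * wordEval X α := by
  simp [wordEval]

theorem wordEval_one {n : ℕ} {A : Type*} [Monoid A] (X : Fin n → A) : wordEval X 1 = 1 := by
  simp [wordEval]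

theorem words_zero (n : ℕ) : words n 0 = {1} := by
  ext α
  rw [mem_words, FreeMonoid.length_eq_zero, Finset.mem_singleton]

theorem sum_words_succ {n k : ℕ} {M : Type*} [AddCommMonoid M] (f : FreeMonoid (Fin n) → M) :
    ∑ α ∈ words n (k + 1), f α = ∑ i, ∑ α ∈ words n k, f (FreeMonoid.of i * α) := by
  rw [← Finset.sum_product']
  symm
  refine Finset.sum_bij (fun p _ => FreeMonoid.of p.1 * p.2) ?_ ?_ ?_ fun _ _ => rfl
  · rintro ⟨i, α⟩ h
    have h' := mem_words.1 (Finset.mem_product.1 h).2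
    rw [mem_words, FreeMonoid.length_mul, FreeMonoid.length_of, h', add_comm]
  · rintro ⟨i, α⟩ _ ⟨j, β⟩ _ h
    obtain ⟨h1, h2⟩ := List.cons.inj h
    exact Prod.ext h1 h2
  · intro α hα
    rw [mem_words] at hα
    induction α using FreeMonoid.inductionOn' with
    | one => simp at hα
    | of_mul i β _ =>
      refine ⟨(i, β), Finset.mem_product.2 ⟨Finset.mem_univ _, mem_words.2 ?_⟩, rfl⟩
      rw [FreeMonoid.length_mul, FreeMonoid.length_of] at hα
      show β.length = k
      omega

theorem homPart_zero {n : ℕ} {R A : Type*} [CommSemiring R] [Semiring A] [Algebra R A]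
    (a : FreeMonoid (Fin n) → R) (X : Fin n → A) : homPart a 0 X = a 1 • 1 := by
  simp [homPart, words_zero, wordEval_one]

theorem ncPoly_apply_zero {n m : ℕ} (hm : 1 ≤ m) (a : FreeMonoid (Fin n) → ℂ) :
    ncPoly a m (0 : Fin n → ℂ) = a 1 := by
  rw [ncPoly, Finset.sum_eq_single_of_mem 0 (Finset.mem_range.2 hm), homPart_zero]
  · simp
  · intro k _ hk
    obtain ⟨k, rfl⟩ := Nat.exists_eq_succ_of_ne_zero hk
    simp [homPart, sum_words_succ, wordEval_of_mul]

/-! ### Creation operators -/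

theorem inner_leftCreation {n : ℕ} (e e' : EuclideanSpace ℂ (Fin n)) (φ ψ : Fock n) :
    inner ℂ (leftCreation e φ) (leftCreation e' ψ) = inner ℂ e e' * inner ℂ φ ψ := by
  have h := lp.hasSum_inner (𝕜 := ℂ) (leftCreation e φ) (leftCreation e' ψ)
  have h2 := (lp.hasSum_inner (𝕜 := ℂ) φ ψ).mul_left (inner ℂ e e')
  rw [← hasSum_nat_add_iff' 1] at h
  have h0 : inner ℂ (leftCreation e φ 0) (leftCreation e' ψ 0) = 0 := inner_zero_left _
  rw [Finset.sum_range_one, h0, sub_zero] at h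
  refine h.unique (h2.congr_fun ?_)
  intro k
  exact TensorProduct.inner_tmul ..

theorem inner_S {n : ℕ} (i j : Fin n) (φ ψ : Fock n) :
    inner ℂ (S n i φ) (S n j ψ) = if i = j then inner ℂ φ ψ else 0 := by
  rw [S, S, inner_leftCreation, EuclideanSpace.inner_single_left]
  simp

/-- The vacuum vector. -/
noncomputable def vacuum (n : ℕ) : Fock n := lp.single 2 0 (show TensorPow n 0 from (1 : ℂ))

theorem inner_vacuum_S {n : ℕ} (i : Fin n) (φ : Fock n) :
    inner ℂ (vacuum n) (S n i φ) = 0 := by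
  rw [vacuum, lp.inner_single_left]
  exact inner_zero_right _

theorem inner_vacuum_self (n : ℕ) : inner ℂ (vacuum n) (vacuum n) = (1 : ℂ) := by
  rw [vacuum, lp.inner_single_left, lp.single_apply_self]
  exact (inner_self_eq_norm_sq_to_K (𝕜 := ℂ) (1 : ℂ)).trans (by simp)

-- The `S_i` are isometries with orthogonal ranges, so equal first letters cancel and different ones
-- give `0`. Equal lengths ensure that both words run out together.
open Classical in
theorem inner_wordEval_S {n : ℕ} (α β : FreeMonoid (Fin n)) (h : α.length = β.length)
    (φ ψ : Fock n) : inner ℂ (wordEval (S n) α φ) (wordEval (S n) β ψ)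
      = if α = β then inner ℂ φ ψ else 0 := by
  induction α using FreeMonoid.inductionOn' generalizing β with
  | one =>
    rw [FreeMonoid.length_one, eq_comm, FreeMonoid.length_eq_zero] at h
    simp [h, wordEval_one]
  | of_mul i α ih =>
    induction β using FreeMonoid.inductionOn' with
    | one => simp at h
    | of_mul j β _ =>
      simp only [FreeMonoid.length_mul, FreeMonoid.length_of, add_right_inj] at h
      have hc : FreeMonoid.of i * α = FreeMonoid.of j * β ↔ i = j ∧ α = β := by
        refine ⟨fun h => List.cons.inj h, ?_⟩
        rintro ⟨rfl, rfl⟩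
        rfl
      simp only [wordEval_of_mul, mul_apply_eq_comp, inner_S, ih β h, hc, ite_and]

/-- Cross terms between distinct words of one length vanish, so a homogeneous part is a scalar
multiple of an isometry. -/
theorem inner_homPart_S {n : ℕ} (a : FreeMonoid (Fin n) → ℂ) (k : ℕ) (φ ψ : Fock n) :
    inner ℂ (homPart a k (S n) φ) (homPart a k (S n) ψ)
      = ((∑ α ∈ words n k, ‖a α‖ ^ 2 : ℝ) : ℂ) * inner ℂ φ ψ := by
  simp only [homPart, sum_apply, smul_apply, sum_inner,
    inner_sum, inner_smul_left, inner_smul_right]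
  push_cast
  rw [Finset.sum_mul]
  refine Finset.sum_congr rfl fun α hα => ?_
  rw [Finset.sum_eq_single_of_mem α hα, inner_wordEval_S α α rfl, if_pos rfl, ← mul_assoc,
    ← Complex.conj_mul', mul_comm (a α)]
  · intro β hβ hne
    rw [inner_wordEval_S β α ((mem_words.1 hβ).trans (mem_words.1 hα).symm), if_neg hne,
      mul_zero]

theorem inner_vacuum_homPart_S {n : ℕ} (a : FreeMonoid (Fin n) → ℂ) {k : ℕ} (hk : 1 ≤ k)
    (φ : Fock n) : inner ℂ (vacuum n) (homPart a k (S n) φ) = 0 := by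
  obtain ⟨k, rfl⟩ := Nat.exists_eq_add_of_le' hk
  simp [homPart, sum_apply, sum_words_succ,
    wordEval_of_mul, inner_vacuum_S]

/-! ### The gauge action -/

theorem memℓp_gauge {n : ℕ} {z : ℂ} (hz : ‖z‖ = 1) (φ : Fock n) :
    Memℓp (fun k => z ^ k • φ k : ∀ k, TensorPow n k) 2 := by
  apply memℓp_gen
  simpa [norm_smul, hz] using (lp.memℓp φ).summable (by norm_num)

/-- The gauge action of the circle on the Fock space: multiplication by `z ^ k` in degree `k`. -/
noncomputable def gauge {n : ℕ} {z : ℂ} (hz : ‖z‖ = 1) : Fock n →ₗ[ℂ] Fock n where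
  toFun φ := ⟨fun k => z ^ k • φ k, memℓp_gauge hz φ⟩
  map_add' φ ψ := by
    ext k
    exact smul_add (z ^ k) (φ k) (ψ k)
  map_smul' c φ := by
    ext k
    exact smul_comm (z ^ k) c (φ k)

theorem gauge_apply {n : ℕ} {z : ℂ} (hz : ‖z‖ = 1) (φ : Fock n) (k : ℕ) :
    gauge hz φ k = z ^ k • φ k := rfl

theorem inner_gauge {n : ℕ} {z : ℂ} (hz : ‖z‖ = 1) (φ ψ : Fock n) :
    inner ℂ (gauge hz φ) (gauge hz ψ) = inner ℂ φ ψ := by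
  rw [lp.inner_eq_tsum, lp.inner_eq_tsum]
  refine tsum_congr fun k => ?_
  rw [gauge_apply, gauge_apply, inner_smul_left, inner_smul_right, ← mul_assoc,
    Complex.conj_mul']
  simp [hz]

theorem gauge_S {n : ℕ} {z : ℂ} (hz : ‖z‖ = 1) (i : Fin n) (φ : Fock n) :
    gauge hz (S n i φ) = z • S n i (gauge hz φ) := by
  ext k
  cases k with
  | zero => exact (smul_zero (z ^ 0)).trans (smul_zero z).symm
  | succ k =>
    change z ^ (k + 1) • tensorLeft _ k (φ k) = z • tensorLeft _ k (z ^ k • φ k)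
    rw [map_smul, smul_smul, pow_succ']

theorem gauge_wordEval_S {n : ℕ} {z : ℂ} (hz : ‖z‖ = 1) (α : FreeMonoid (Fin n)) (φ : Fock n) :
    gauge hz (wordEval (S n) α φ) = z ^ α.length • wordEval (S n) α (gauge hz φ) := by
  induction α using FreeMonoid.inductionOn' with
  | one => simp [wordEval_one]
  | of_mul i α ih =>
    rw [wordEval_of_mul, mul_apply_eq_comp, gauge_S, ih, map_smul, smul_smul,
      FreeMonoid.length_mul, FreeMonoid.length_of, pow_add, pow_one, mul_apply_eq_comp]

theorem gauge_homPart_S {n : ℕ} {z : ℂ} (hz : ‖z‖ = 1) (a : FreeMonoid (Fin n) → ℂ) (k : ℕ)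
    (φ : Fock n) :
    gauge hz (homPart a k (S n) φ) = z ^ k • homPart a k (S n) (gauge hz φ) := by
  simp only [homPart, sum_apply, smul_apply, map_sum,
    map_smul, Finset.smul_sum]
  refine Finset.sum_congr rfl fun α hα => ?_
  rw [gauge_wordEval_S, mem_words.1 hα, smul_comm]

theorem inner_gauge_homPart_S {n : ℕ} {z : ℂ} (hz : ‖z‖ = 1) (a : FreeMonoid (Fin n) → ℂ)
    (k : ℕ) (φ : Fock n) :
    z ^ k * inner ℂ (gauge hz φ) (homPart a k (S n) (gauge hz φ))
      = inner ℂ φ (homPart a k (S n) φ) := by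
  rw [← inner_smul_right, ← gauge_homPart_S, inner_gauge]

/-! ### Coefficient estimates -/

theorem re_inner_le_of_realPart_le_one {H : Type*} [NormedAddCommGroup H] [InnerProductSpace ℂ H]
    [CompleteSpace H] {A : H →L[ℂ] H} (hA : (realPart A : H →L[ℂ] H) ≤ 1) (x : H) :
    (inner ℂ x (A x)).re ≤ ‖x‖ ^ 2 := by
  have h := (ContinuousLinearMap.le_def _ _).1 hA
  have h2 := h.re_inner_nonneg_right x
  have h3 : inner ℂ x (star A x) = (starRingEnd ℂ) (inner ℂ x (A x)) := by
    rw [ContinuousLinearMap.star_eq_adjoint, ContinuousLinearMap.adjoint_inner_right,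
      inner_conj_symm]
  have h4 : (inner ℂ x ((2 : ℝ)⁻¹ • (A x + star A x))).re = (inner ℂ x (A x)).re := by
    rw [inner_smul_right_eq_smul, inner_add_right, h3, Complex.smul_re, Complex.add_re,
      Complex.conj_re, smul_eq_mul]
    ring
  rw [realPart_apply_coe, sub_apply, one_apply_eq_self,
    inner_sub_right, map_sub, smul_apply, add_apply,
    inner_self_eq_norm_sq] at h2
  simp only [RCLike.re_eq_complex_re, h4] at h2
  linarith

theorem re_inner_homPart_le {n m k : ℕ} (hk : 1 ≤ k) (hkm : k < m) {a : FreeMonoid (Fin n) → ℂ}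
    (h : (realPart (ncPoly a m (S n)) : Fock n →L[ℂ] Fock n) ≤ 1) (φ : Fock n) :
    (inner ℂ φ (homPart a k (S n) φ)).re ≤
      2 * Real.cos (Real.pi / ((((m - 1) / k : ℕ) : ℝ) + 2)) * (1 - (a 1).re) * ‖φ‖ ^ 2 := by
  have key := fejer hk hkm (fun l => inner ℂ φ (homPart a l (S n) φ)) (‖φ‖ ^ 2) (by
    intro z hz
    -- Gauging by `z⁻¹` multiplies `⟪φ, P_l φ⟫` by `z ^ l`, which is the form `fejer` needs.
    have hz' : ‖z⁻¹‖ = 1 := by rw [norm_inv, hz, inv_one]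
    have hz0 : z ≠ 0 := fun h0 => by simp [h0] at hz
    have h1 := re_inner_le_of_realPart_le_one h (gauge hz' φ)
    have h2 : ‖gauge hz' φ‖ = ‖φ‖ := by
      rw [@norm_eq_sqrt_re_inner ℂ, inner_gauge, ← @norm_eq_sqrt_re_inner ℂ]
    rw [h2, ncPoly, sum_apply, inner_sum] at h1
    refine le_of_eq_of_le ?_ h1
    congr 1
    refine Finset.sum_congr rfl fun l _ => ?_
    rw [← inner_gauge_homPart_S hz' a l φ, ← mul_assoc, ← mul_pow, mul_inv_cancel₀ hz0, one_pow,
      one_mul])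
  refine key.trans (le_of_eq ?_)
  have h0 : (inner ℂ φ (homPart a 0 (S n) φ)).re = (a 1).re * ‖φ‖ ^ 2 := by
    rw [homPart_zero, smul_apply, one_apply_eq_self,
      inner_smul_right, inner_self_eq_norm_sq_to_K]
    rw [mul_comm, ← RCLike.ofReal_pow, mul_comm (a 1).re]
    exact Complex.re_ofReal_mul _ _
  rw [h0]
  ring

/-- The numerical radius of a multiple `c V` of an isometry with a wandering vector is at
least `c`. -/
theorem le_of_re_inner_le {H : Type*} [NormedAddCommGroup H] [InnerProductSpace ℂ H]
    {V : H →L[ℂ] H} {c d : ℝ} (hc : 0 ≤ c)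
    (hV : ∀ x y, inner ℂ (V x) (V y) = ((c ^ 2 : ℝ) : ℂ) * inner ℂ x y) {ω : H}
    (hω : inner ℂ ω ω = (1 : ℂ)) (hωV : ∀ x, inner ℂ ω (V x) = (0 : ℂ))
    (hd : ∀ x, (inner ℂ x (V x)).re ≤ d * ‖x‖ ^ 2) : c ≤ d := by
  have hsq : ∀ x : H, ‖x‖ ^ 2 = (inner ℂ x x).re := fun x =>
    (inner_self_eq_norm_sq (𝕜 := ℂ) x).symm
  rcases hc.eq_or_lt with rfl | hc
  -- For `c = 0`, testing on `ω` gives `0 ≤ d`.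
  · have := hd ω
    rw [hsq, hω, hωV] at this
    simpa using this
  have hc0 : (c : ℂ) ≠ 0 := by exact_mod_cast hc.ne'
  -- The orbit of `ω` under the isometry `V / c` is orthonormal, and `V` acts on it as `c` times the
  -- unilateral shift.
  set e : ℕ → H := fun j => ((c : ℂ)⁻¹ • V : H →L[ℂ] H)^[j] ω with he
  have hes : ∀ j, e (j + 1) = (c : ℂ)⁻¹ • V (e j) := fun j => by
    simp only [he, Function.iterate_succ_apply', smul_apply]
  have hVe : ∀ j, V (e j) = (c : ℂ) • e (j + 1) := fun j => by
    rw [hes, smul_smul, mul_inv_cancel₀ hc0, one_smul]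
  have hee : ∀ i j, inner ℂ (e i) (e j) = if i = j then (1 : ℂ) else 0 := by
    intro i
    induction i with
    | zero =>
      intro j
      cases j with
      | zero => simpa [he] using hω
      | succ j =>
        rw [hes, inner_smul_right]
        simp [he, hωV]
    | succ i ih =>
      intro j
      cases j with
      | zero =>
        rw [hes, inner_smul_left, ← inner_conj_symm]
        simp [he, hωV]
      | succ j =>
        rw [hes, hes, inner_smul_left, inner_smul_right, hV, ih]
        simp only [add_left_inj]
        split_ifs
        · simp
          field_simp
        · simp
  -- The test vector `e_0 + ⋯ + e_M` has squared norm `M + 1`, and its shift overlaps it in `M`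
  -- terms. Letting `M` grow forces `c ≤ d`.
  have hM : ∀ M : ℕ, c * M ≤ d * (M + 1) := by
    intro M
    have h := hd (∑ j ∈ Finset.range (M + 1), e j)
    rw [hsq, map_sum] at h
    simp only [hVe, sum_inner, inner_sum, inner_smul_right, hee] at h
    have h1 : ∑ j ∈ Finset.range (M + 1), ∑ i ∈ Finset.range (M + 1),
        (if i = j then (1 : ℂ) else 0) = ((M + 1 : ℝ) : ℂ) := by
      rw [Finset.sum_congr rfl fun j hj => by rw [Finset.sum_ite_eq', if_pos hj]]
      simp
    have h2 : ∑ j ∈ Finset.range (M + 1), (c : ℂ) * ∑ i ∈ Finset.range (M + 1),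
        (if i = j + 1 then (1 : ℂ) else 0) = ((c * M : ℝ) : ℂ) := by
      simp only [Finset.sum_ite_eq', Finset.mem_range, add_lt_add_iff_right]
      rw [Finset.sum_range_succ, Finset.sum_congr rfl fun j hj => by
        rw [if_pos (Finset.mem_range.1 hj)]]
      simp [mul_comm]
    rw [h1, h2, Complex.ofReal_re, Complex.ofReal_re] at h
    exact h
  by_contra! hlt
  obtain ⟨M, hM'⟩ := exists_nat_gt (d / (c - d))
  rw [div_lt_iff₀ (by linarith)] at hM'
  have := hM M
  nlinarith

theorem sqrt_sum_sq_coeff_le {n m k : ℕ} (hk : 1 ≤ k) (hkm : k < m)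
    {a : FreeMonoid (Fin n) → ℂ}
    (h : (realPart (ncPoly a m (S n)) : Fock n →L[ℂ] Fock n) ≤ 1) :
    √(∑ α ∈ words n k, ‖a α‖ ^ 2) ≤
      2 * Real.cos (Real.pi / ((((m - 1) / k : ℕ) : ℝ) + 2)) * (1 - (a 1).re) := by
  refine le_of_re_inner_le (Real.sqrt_nonneg _) (fun x y => ?_) (inner_vacuum_self n)
    (inner_vacuum_homPart_S a hk) (re_inner_homPart_le hk hkm h)
  rw [Real.sq_sqrt (Finset.sum_nonneg fun _ _ => by positivity), inner_homPart_S]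

/-! ### Row contractions -/

theorem sqrt_pow_of_nonneg {x : ℝ} (hx : 0 ≤ x) (k : ℕ) : √(x ^ k) = √x ^ k := by
  rw [Real.sqrt_eq_iff_mul_self_eq (by positivity) (by positivity), ← mul_pow,
    Real.mul_self_sqrt hx]

/-- Induction on length: the adjoint of `T_i T_α` applies `T_i*` first, so the bound for `α` is used
at `T_i* x`, and `∑ ‖T_i* x‖² = ⟪x, ∑ T_i T_i* x⟫`. -/
theorem sum_norm_sq_star_wordEval_le {n : ℕ} {K : Type*} [NormedAddCommGroup K]
    [InnerProductSpace ℂ K] [CompleteSpace K] (T : Fin n → K →L[ℂ] K) (k : ℕ) (x : K) :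
    ∑ α ∈ words n k, ‖star (wordEval T α) x‖ ^ 2 ≤ ‖∑ i, T i * star (T i)‖ ^ k * ‖x‖ ^ 2 := by
  induction k generalizing x with
  | zero => simp [words_zero, wordEval_one]
  | succ k ih =>
    rw [sum_words_succ]
    have h1 : ∑ i, ‖star (T i) x‖ ^ 2 ≤ ‖∑ i, T i * star (T i)‖ * ‖x‖ ^ 2 := by
      have h2 : ((∑ i, ‖star (T i) x‖ ^ 2 : ℝ) : ℂ)
          = inner ℂ x ((∑ i, T i * star (T i)) x) := by
        simp only [Complex.ofReal_sum, Complex.ofReal_pow]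
        rw [sum_apply, inner_sum]
        refine Finset.sum_congr rfl fun i _ => ?_
        rw [mul_apply_eq_comp, ← ContinuousLinearMap.adjoint_inner_left,
          ContinuousLinearMap.star_eq_adjoint, inner_self_eq_norm_sq_to_K]
        rfl
      have h3 : ‖((∑ i, ‖star (T i) x‖ ^ 2 : ℝ) : ℂ)‖ = ∑ i, ‖star (T i) x‖ ^ 2 :=
        Complex.norm_of_nonneg (Finset.sum_nonneg fun _ _ => by positivity)
      rw [← h3, h2]
      calc _ ≤ ‖x‖ * ‖(∑ i, T i * star (T i)) x‖ := norm_inner_le_norm _ _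
        _ ≤ ‖x‖ * (‖∑ i, T i * star (T i)‖ * ‖x‖) := by
          gcongr
          exact ContinuousLinearMap.le_opNorm _ _
        _ = _ := by ring
    calc _ ≤ ∑ i, ‖∑ i, T i * star (T i)‖ ^ k * ‖star (T i) x‖ ^ 2 := by
          refine Finset.sum_le_sum fun i _ => ?_
          simp only [wordEval_of_mul, star_mul, mul_apply_eq_comp]
          exact ih _
      _ ≤ ‖∑ i, T i * star (T i)‖ ^ k * (‖∑ i, T i * star (T i)‖ * ‖x‖ ^ 2) := by
          rw [← Finset.mul_sum]
          gcongr
      _ = _ := by ring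

theorem norm_homPart_le {n : ℕ} {K : Type*} [NormedAddCommGroup K]
    [InnerProductSpace ℂ K] [CompleteSpace K] (T : Fin n → K →L[ℂ] K)
    (c : FreeMonoid (Fin n) → ℂ) (k : ℕ) :
    ‖homPart c k T‖ ≤ √(∑ α ∈ words n k, ‖c α‖ ^ 2) * √‖∑ i, T i * star (T i)‖ ^ k := by
  -- The row norm controls the adjoints `T_α*` jointly, so Cauchy–Schwarz over words is applied to
  -- the adjoint.
  rw [← norm_star]
  refine ContinuousLinearMap.opNorm_le_bound _ (by positivity) fun x => ?_
  rw [homPart, star_sum, sum_apply]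
  calc _ ≤ ∑ α ∈ words n k, ‖c α‖ * ‖star (wordEval T α) x‖ := by
        refine (norm_sum_le _ _).trans (le_of_eq (Finset.sum_congr rfl fun α _ => ?_))
        rw [star_smul, smul_apply, norm_smul, norm_star]
    _ ≤ √(∑ α ∈ words n k, ‖c α‖ ^ 2) * √(∑ α ∈ words n k, ‖star (wordEval T α) x‖ ^ 2) :=
        Real.sum_mul_le_sqrt_mul_sqrt _ _ _
    _ ≤ √(∑ α ∈ words n k, ‖c α‖ ^ 2) * √(‖∑ i, T i * star (T i)‖ ^ k * ‖x‖ ^ 2) := by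
        gcongr
        exact sum_norm_sq_star_wordEval_le T k x
    _ = _ := by
        rw [Real.sqrt_mul (by positivity), Real.sqrt_sq (norm_nonneg _),
          sqrt_pow_of_nonneg (norm_nonneg _), mul_assoc]

theorem sum_sq_wordEval {n : ℕ} (r : Fin n → ℝ) (k : ℕ) :
    ∑ α ∈ words n k, wordEval r α ^ 2 = (∑ i, r i ^ 2) ^ k := by
  induction k with
  | zero => simp [words_zero, wordEval_one]
  | succ k ih =>
    simp only [sum_words_succ, wordEval_of_mul, mul_pow, ← Finset.mul_sum, ih]
    rw [← Finset.sum_mul, pow_succ']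

theorem homPart_le_of_real {n : ℕ} (r : EuclideanSpace ℝ (Fin n)) (c : FreeMonoid (Fin n) → ℝ)
    (k : ℕ) : homPart c k (fun i => r i) ≤ √(∑ α ∈ words n k, c α ^ 2) * ‖r‖ ^ k := by
  refine (Real.sum_mul_le_sqrt_mul_sqrt _ _ _).trans (le_of_eq ?_)
  rw [sum_sq_wordEval, EuclideanSpace.norm_eq, sqrt_pow_of_nonneg
    (Finset.sum_nonneg fun _ _ => by positivity)]
  simp

/-! ### The Bohr inequality -/

/-- The abstract sequence `v` stands for the operator norms as well as for the scalar values at `r`,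
so both conclusions follow from one estimate. -/
theorem sum_range_le_one_of_homPart_le {n m : ℕ} (hm : 2 ≤ m) {a : FreeMonoid (Fin n) → ℂ}
    (h0 : 0 ≤ a 1) (h : (realPart (ncPoly a m (S n)) : Fock n →L[ℂ] Fock n) ≤ 1) {s t : ℝ}
    (hs : 0 ≤ s) (hst : s ≤ t) (ht : fejerSum m t = 1 / 2) {v : ℕ → ℝ}
    (hv : ∀ k, v k ≤ √(∑ α ∈ words n k, ‖a α‖ ^ 2) * s ^ k) :
    ∑ k ∈ Finset.range m, v k ≤ 1 := by
  have ha : ‖a 1‖ = (a 1).re := by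
    rw [← Complex.re_eq_norm] at h0
    exact h0.symm
  -- `a_0 ≤ 1` is read off from the coefficient bound for `k = 1`, whose cosine is at least `1/2`.
  have ha1 : 0 ≤ 1 - (a 1).re := by
    have h1 := (Real.sqrt_nonneg _).trans (sqrt_sum_sq_coeff_le le_rfl (by omega : 1 < m) h)
    have h2 := half_le_cos_pi_div_add_two (j := (m - 1) / 1) (by simp; omega)
    exact nonneg_of_mul_nonneg_right h1 (by linarith)
  have hr : Finset.range m = insert 0 (Finset.Icc 1 (m - 1)) := by
    ext k
    simp only [Finset.mem_range, Finset.mem_insert, Finset.mem_Icc]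
    omega
  rw [hr, Finset.sum_insert (by simp)]
  have hv0 : v 0 ≤ (a 1).re := by
    simpa [words_zero, Real.sqrt_sq (norm_nonneg (a 1)), ← ha] using hv 0
  have hv1 : ∑ k ∈ Finset.Icc 1 (m - 1), v k ≤ 2 * (1 - (a 1).re) * fejerSum m t := by
    rw [fejerSum, Finset.mul_sum]
    refine Finset.sum_le_sum fun k hk => (hv k).trans ?_
    obtain ⟨hk1, hk2⟩ := Finset.mem_Icc.1 hk
    have h1 := sqrt_sum_sq_coeff_le hk1 (by omega : k < m) h
    calc _ ≤ 2 * Real.cos (Real.pi / ((((m - 1) / k : ℕ) : ℝ) + 2)) * (1 - (a 1).re) * t ^ k :=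
          mul_le_mul h1 (pow_le_pow_left₀ hs hst k) (by positivity)
            ((Real.sqrt_nonneg _).trans h1)
      _ = _ := by ring
  rw [ht] at hv1
  linarith

end BohrNC

theorem theorem1p1 :
    ∃ t : ℕ → ℝ,
      -- for `m ≥ 2`, `t m` lies in `(0, 1]` and is the unique positive solution of the equation
      (∀ m : ℕ, 2 ≤ m → t m ∈ Set.Ioc (0 : ℝ) 1 ∧
        ∀ s : ℝ, 0 < s → (BohrNC.fejerSum m s = 1 / 2 ↔ s = t m)) ∧
      StrictAntiOn t (Set.Ici 2) ∧
      Filter.Tendsto t Filter.atTop (nhds (1 / 3)) ∧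
      ∀ (n m : ℕ), 1 ≤ n → 2 ≤ m → ∀ a : FreeMonoid (Fin n) → ℂ,
        0 ≤ BohrNC.ncPoly a m (0 : Fin n → ℂ) →
        (realPart (BohrNC.ncPoly a m (BohrNC.S n)) : BohrNC.Fock n →L[ℂ] BohrNC.Fock n) ≤ 1 →
        (∀ (K : Type u) [NormedAddCommGroup K] [InnerProductSpace ℂ K] [CompleteSpace K]
          (T : Fin n → K →L[ℂ] K),
          Real.sqrt ‖∑ i, T i * star (T i)‖ ≤ t m →
          ∑ k ∈ Finset.range m,
            ‖BohrNC.homPart (fun α => ((‖a α‖ : ℝ) : ℂ)) k T‖ ≤ 1) ∧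
        (∀ r : EuclideanSpace ℝ (Fin n), (∀ i, 0 ≤ r i) → ‖r‖ ≤ t m →
          BohrNC.ncPoly (fun α => ‖a α‖) m (fun i => r i) ≤ 1) := by
  obtain ⟨t, ht, hanti, hlim⟩ := BohrNC.exists_fejerSum_solutions
  refine ⟨t, ht, hanti, hlim, fun n m _ hm a h0 hre => ?_⟩
  rw [BohrNC.ncPoly_apply_zero (by omega)] at h0
  have hval : BohrNC.fejerSum m (t m) = 1 / 2 := ((ht m hm).2 _ (ht m hm).1.1).2 rfl
  refine ⟨fun K _ _ _ T hT => ?_, fun r _ hr => ?_⟩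
  · refine BohrNC.sum_range_le_one_of_homPart_le hm h0 hre (Real.sqrt_nonneg _) hT hval
      fun k => ?_
    simpa using BohrNC.norm_homPart_le T (fun α => ((‖a α‖ : ℝ) : ℂ)) k
  · exact BohrNC.sum_range_le_one_of_homPart_le hm h0 hre (norm_nonneg r) hr hval
      fun k => BohrNC.homPart_le_of_real r (fun α => ‖a α‖) k
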